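/- **Setting.** There are $m$ clients; client $i$ holds a dataset $D_i=(x^{(i)}_1,\dots,x^{(i)}_{n_i})$ of $n_i\ge 1$ points of a space $\mathcal X$, and $N=\sum_{i=1}^m n_i$. Let $\rho(x,\theta)$, $x\in\mathcal X$, $\theta\in\mathbb R^d$, be a loss function that is differentiable in $\theta$ and satisfies $\|\nabla_\theta\rho(x,\theta)\|\le B$ for all $x\in\mathcal X$ and $\theta\in\mathbb R^d$. Let $w_1,\dots,w_m\in[0,1]$ with $\sum_i w_i=1$ be weights, $\eta$ a step size, $K$ a number of iterations, $\mu>0$ a privacy parameter and $\theta^{(0)}\in\mathbb R^d$ an arbitrary (fixed) initial value. `FedSGD` with client noise scales $\sigma_1,\dots,\sigma_m$ computes, for $k=0,\dots,K-1$, $$\tilde g_i^{(k)}=\frac1{n_i}\sum_{j=1}^{n_i}\nabla_\theta\rho\big(x^{(i)}_j,\theta^{(k)}\big)+\sigma_i Z_{ik}\quad(1\le i\le m),\qquad \theta^{(k+1)}=\theta^{(k)}-\eta\sum_{i=1}^m w_i\,\tilde g_i^{(k)},$$ where the $Z_{ik}\sim\mathcal N(0,I_d)$ are independent. Client $i$ sends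 $\tilde g_i^{(k)}$ to the server, and the server broadcasts $\theta^{(k+1)}$; the output is $\theta^{(K)}$. **Privacy.** For probability laws $P,Q$ let $T(\alpha,P,Q)=\inf\{1-\mathbb E_Q\phi:\ \mathbb E_P\phi\le\alpha\}$, the infimum being over measurable $0\le\phi\le1$, and let $\Phi$ be the standard Gaussian cdf (with $\Phi(-\infty)=0$, $\Phi^{-1}(0)=-\infty$). A randomized mechanism $M$ is $\nu$-GDP if $$T(\alpha,M(D),M(D'))\ge\Phi(\Phi^{-1}(1-\alpha)-\nu)\quad\text{for all }\alpha\in(0,1]\qquad(\ast)$$ (with $M(D)$ denoting the law of its output) for any two datasets $D,D'$ of size $N$ that differ in exactly one datum. A mechanism on federated datasets $(D_1,\dots,D_m)$ is $\nu$-fed-GDP if, for every client $s$, the inequality $(\ast)$ holds whenever the datasets $D_j$, $j\ne s$, of the other clients are held fixed and $D_s$ is replaced by a dataset $D_s'$ of size $n_s$ that differs from $D_s$ in exactly one datum. **Lemma 3.1 (privacy of `FedSGD`).** Let the noise scales be $\sigma_i=\dfrac{2B\sqrt K}{\mu n_i}$ for $i=1,\dots,m$. Then 1. `FedSGD` is $\mu$-fed-GDP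 toward the server, that is, the mechanism that releases all the messages $\big(\tilde g_i^{(k)}\big)_{1\le i\le m,\ 0\le k<K}$ is $\mu$-fed-GDP. 2. If the server averages with the weights $w_i=n_i/N$, then the full algorithm is $\mu/\sqrt m$-GDP toward a third party observing the server's outputs, that is, the mechanism on the pooled dataset of size $N$ that releases all the iterates $\theta^{(0)},\theta^{(1)},\dots,\theta^{(K)}$ is $\mu/\sqrt m$-GDP. -/

import Mathlib

open MeasureTheory ProbabilityTheory

noncomputable section

/-! ## Gaussian differential privacy -/

/-- The standard Gaussian cdf `Φ`, extended to `[-∞, ∞]` (so `Φ(-∞) = 0` and `Φ(∞) = 1`). -/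
def gaussCDF (x : EReal) : ℝ :=
  (gaussianReal 0 1).real {t : ℝ | (t : EReal) ≤ x}

/-- The quantile function `Φ⁻¹`, with values in `[-∞, ∞]` (so `Φ⁻¹(0) = -∞`). -/
def gaussQuantile (p : ℝ) : EReal :=
  sInf {x : EReal | p ≤ gaussCDF x}

/-- The trade-off function `T(α, P, Q)`: the least type II error of a measurable randomized
test `φ` of `P` against `Q` with type I error at most `α`. -/
def tradeoff {Ω : Type*} [MeasurableSpace Ω] (α : ℝ) (P Q : Measure Ω) : ℝ :=
  sInf {β : ℝ | ∃ φ : Ω → ℝ, Measurable φ ∧ (∀ ω, 0 ≤ φ ω ∧ φ ω ≤ 1) ∧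
    ∫ ω, φ ω ∂P ≤ α ∧ β = 1 - ∫ ω, φ ω ∂Q}

/-- Two datasets of the same size differ in exactly one datum. -/
def DifferInOne {ι X : Type*} (D D' : ι → X) : Prop :=
  ∃ p, D p ≠ D' p ∧ ∀ q, q ≠ p → D q = D' q

/-- A randomized mechanism, given by the law `M D` of its output on the dataset `D`,
is `μ`-GDP. -/
def IsGDP {ι X Ω : Type*} [MeasurableSpace Ω] (μ : ℝ) (M : (ι → X) → Measure Ω) : Prop :=
  ∀ D D' : ι → X, DifferInOne D D' → ∀ α : ℝ, 0 < α → α ≤ 1 →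
    gaussCDF (gaussQuantile (1 - α) - (μ : EReal)) ≤ tradeoff α (M D) (M D')

/-- Federated datasets: client `i` holds `n i` data. -/
abbrev FedData {m : ℕ} (n : Fin m → ℕ) (X : Type*) : Type _ :=
  (i : Fin m) → Fin (n i) → X

/-- A randomized mechanism on federated datasets is `μ`-fed-GDP: for every client `s`, when
the data of all the other clients are held fixed and two datasets of client `s` differ in exactly
one datum, the trade-off function between the two laws of what is observed is at least that of
`N(0,1)` against `N(μ,1)`. -/
def IsFedGDP {m : ℕ} {n : Fin m → ℕ} {X Ω : Type*} [MeasurableSpace Ω] (μ : ℝ)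
    (M : FedData n X → Measure Ω) : Prop :=
  ∀ (s : Fin m) (D D' : FedData n X), DifferInOne (D s) (D' s) → (∀ j, j ≠ s → D j = D' j) →
    ∀ α : ℝ, 0 < α → α ≤ 1 →
      gaussCDF (gaussQuantile (1 - α) - (μ : EReal)) ≤ tradeoff α (M D) (M D')

/-! ## The FedSGD algorithm -/

/-- The inputs of FedSGD with `m` clients, parameters in `ℝ^d` and data in `X`. -/
structure FedSGD (X : Type*) (d m : ℕ) where
  /-- the loss function `ρ(x, θ)` -/
  loss : X → EuclideanSpace ℝ (Fin d) → ℝ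
  /-- the number of iterations -/
  K : ℕ
  /-- the step size -/
  eta : ℝ
  /-- the initial value `θ⁽⁰⁾` -/
  theta0 : EuclideanSpace ℝ (Fin d)
  /-- the aggregation weights of the server -/
  w : Fin m → ℝ
  /-- the scales of the Gaussian noise of the clients -/
  sigma : Fin m → ℝ

namespace FedSGD

variable {X : Type*} {d m : ℕ} {n : Fin m → ℕ}

/-- The standard normal vectors `Z_{ik}`, as an array `z k i`. -/
abbrev Noise (A : FedSGD X d m) : Type :=
  Fin A.K → Fin m → EuclideanSpace ℝ (Fin d)

/-- The law of the noise array: its entries are independent `N(0, I_d)` vectors. -/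
def noiseLaw (A : FedSGD X d m) : Measure A.Noise :=
  Measure.pi fun _ => Measure.pi fun _ => stdGaussian (EuclideanSpace ℝ (Fin d))

/-- `g_i = n_i⁻¹ ∑_j ∇ρ(x_j⁽ⁱ⁾, θ)`, the average gradient at client `i`. -/
def clientGrad (A : FedSGD X d m) (D : FedData n X) (i : Fin m)
    (θ : EuclideanSpace ℝ (Fin d)) : EuclideanSpace ℝ (Fin d) :=
  (1 / (n i : ℝ)) • ∑ j, gradient (A.loss (D i j)) θ

/-- The privatized gradient `g_i + σ_i Z_{ik}` which client `i` computes from the current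
parameter `θ` in iteration `k`. -/
def noisyGrad (A : FedSGD X d m) (D : FedData n X) (z : A.Noise) (k : Fin A.K) (i : Fin m)
    (θ : EuclideanSpace ℝ (Fin d)) : EuclideanSpace ℝ (Fin d) :=
  A.clientGrad D i θ + A.sigma i • z k i

/-- The parameters `θ⁽⁰⁾, …, θ⁽ᴷ⁾`, where
`θ⁽ᵏ⁺¹⁾ = θ⁽ᵏ⁾ - η ∑_i w_i (g_i⁽ᵏ⁾ + σ_i Z_{ik})`. -/
def iterates (A : FedSGD X d m) (D : FedData n X) (z : A.Noise) :
    Fin (A.K + 1) → EuclideanSpace ℝ (Fin d) :=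
  fun k => Fin.induction (motive := fun _ => EuclideanSpace ℝ (Fin d)) A.theta0
    (fun k θ => θ - A.eta • ∑ i, A.w i • A.noisyGrad D z k i θ) k

/-- All the messages `g_i⁽ᵏ⁾ + σ_i Z_{ik}` that the clients send to the server. -/
def messages (A : FedSGD X d m) (D : FedData n X) (z : A.Noise) :
    Fin A.K → Fin m → EuclideanSpace ℝ (Fin d) :=
  fun k i => A.noisyGrad D z k i (A.iterates D z k.castSucc)

/-- The law of what the server observes: the messages of all clients in all iterations. -/
def serverView (A : FedSGD X d m) (D : FedData n X) :
    Measure (Fin A.K → Fin m → EuclideanSpace ℝ (Fin d)) :=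
  A.noiseLaw.map (A.messages D)

/-- The law of what a third party observes: all the parameters broadcast by the server,
of which the last one is the output of the algorithm. -/
def thirdPartyView (A : FedSGD X d m) (D : FedData n X) :
    Measure (Fin (A.K + 1) → EuclideanSpace ℝ (Fin d)) :=
  A.noiseLaw.map (A.iterates D)

/-! The views are measurable functions of the noise, so that their laws above are
genuine push-forwards. -/

theorem measurable_gradient (f : EuclideanSpace ℝ (Fin d) → ℝ) : Measurable (gradient f) :=
  (InnerProductSpace.toDual ℝ _).symm.continuous.measurable.comp (measurable_fderiv ℝ f)

theorem measurable_noisyGrad (A : FedSGD X d m) (D : FedData n X) (k : Fin A.K) (i : Fin m)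
    {θ : A.Noise → EuclideanSpace ℝ (Fin d)} (hθ : Measurable θ) :
    Measurable fun z => A.noisyGrad D z k i (θ z) := by
  unfold noisyGrad clientGrad
  refine Measurable.add (Measurable.fun_const_smul (Finset.measurable_sum _ fun j _ =>
    (measurable_gradient _).comp hθ) _) (Measurable.fun_const_smul ?_ _)
  exact (measurable_pi_apply i).comp (measurable_pi_apply k)

theorem measurable_iterates (A : FedSGD X d m) (D : FedData n X) :
    Measurable (A.iterates D) := by
  refine measurable_pi_lambda _ fun k => ?_
  induction k using Fin.induction with
  | zero => exact measurable_const
  | succ k ih =>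
    have h : (fun z => A.iterates D z k.succ) = fun z => A.iterates D z k.castSucc -
        A.eta • ∑ i, A.w i • A.noisyGrad D z k i (A.iterates D z k.castSucc) := rfl
    rw [h]
    exact ih.sub (Measurable.fun_const_smul (Finset.measurable_sum _ fun i _ =>
      (A.measurable_noisyGrad D k i ih).fun_const_smul _) _)

theorem measurable_messages (A : FedSGD X d m) (D : FedData n X) :
    Measurable (A.messages D) :=
  measurable_pi_lambda _ fun k => measurable_pi_lambda _ fun i =>
    A.measurable_noisyGrad D k i ((measurable_pi_apply _).comp (A.measurable_iterates D))

end FedSGD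

end

/-! Changing one datum can be undone by moving the noise. If the noise of each round is translated
by a suitable amount depending on the current parameter, the run on `D` becomes the run on `D'`
(`iterates_shift`). A test on the views is then a test between the noise law and its adaptively
translated version, so no conditional laws of the views are needed.

Tests are controlled through hockey-stick bounds. A Gaussian translation of squared length `r` has
log-likelihood ratio `N(-r/2, r)`, and successive rounds add their variances. Hence if every round
moves by squared length at most `t²/K`, all `K` rounds are dominated by `N(0,1)` against `N(t,1)`
(`integral_adaptedShift_sub_le`). The Neyman–Pearson threshold turns this into the trade-off bound
(`le_tradeoff_of_hockeyStick`).

Toward the server only the noise of the affected client may move, at length at most `μ/√K` per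
round. A third party sees only the weighted sum of the noises, so the displacement can be spread
evenly over the `m` clients; this gains the factor `1/√m`. -/

section

open Filter Topology
open scoped NNReal

/-! ### Likelihood ratios of Gaussian translations -/

/-- The translate of `γ` by `a` has the density `exp (ℓ - r / 2)` with respect to `γ`, where the
log-likelihood `ℓ` is a centered Gaussian of variance `r` under `γ`. -/
def IsGaussianShift {E : Type*} [MeasurableSpace E] [Add E] (γ : Measure E) (a : E) (r : ℝ≥0) :
    Prop :=
  ∃ ℓ : E → ℝ, Measurable ℓ ∧ γ.map ℓ = gaussianReal 0 r ∧
    γ.map (fun y => y + a) = γ.withDensity fun y => ENNReal.ofReal (Real.exp (ℓ y - r / 2))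

theorem gaussianReal_map_add_eq_withDensity (t : ℝ) :
    (gaussianReal 0 1).map (fun y => y + t) =
      (gaussianReal 0 1).withDensity fun y => ENNReal.ofReal (Real.exp (t * y - t ^ 2 / 2)) := by
  rw [gaussianReal_map_add_const, gaussianReal_of_var_ne_zero _ one_ne_zero,
    gaussianReal_of_var_ne_zero _ one_ne_zero, ← withDensity_mul _ (measurable_gaussianPDF _ _)
      (by fun_prop)]
  congr 1
  ext y
  simp only [gaussianPDF, Pi.mul_apply]
  rw [← ENNReal.ofReal_mul (gaussianPDFReal_nonneg _ _ _)]
  simp only [gaussianPDFReal, mul_assoc, ← Real.exp_add]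
  congr 4
  simp
  ring

theorem isGaussianShift_gaussianReal (t : ℝ) :
    IsGaussianShift (gaussianReal 0 1) t (‖t‖₊ ^ 2) := by
  refine ⟨fun y => t * y, by fun_prop, ?_, ?_⟩
  · rw [gaussianReal_map_const_mul]
    congr 1
    · simp
    · ext; simp
  · rw [gaussianReal_map_add_eq_withDensity]
    simp

/-- The left inverse `g` transports the log-likelihood as `ℓ ∘ g`. -/
theorem IsGaussianShift.map {E F : Type*} [MeasurableSpace E] [Add E] [MeasurableAdd E]
    [MeasurableSpace F] [Add F] [MeasurableAdd F] {γ : Measure E} {a : E} {r : ℝ≥0}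
    (h : IsGaussianShift γ a r) {e : E → F} {g : F → E} (he : Measurable e) (hg : Measurable g)
    (hge : Function.LeftInverse g e) {b : F} (hab : ∀ x, e (x + a) = e x + b) :
    IsGaussianShift (γ.map e) b r := by
  obtain ⟨ℓ, hℓ, hlaw, hdens⟩ := h
  refine ⟨ℓ ∘ g, hℓ.comp hg, ?_, ?_⟩
  · rw [Measure.map_map (hℓ.comp hg) he, Function.comp_assoc, hge.comp_eq_id]
    exact hlaw
  · have : (fun y => y + b) ∘ e = e ∘ fun x => x + a := by ext x; simp [hab]
    rw [Measure.map_map (measurable_add_const b) he, this,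
      ← Measure.map_map he (measurable_add_const a), hdens]
    ext s hs
    rw [Measure.map_apply he hs, withDensity_apply _ (he hs), withDensity_apply _ hs,
      setLIntegral_map hs (by fun_prop) he]
    simp [hge _]

theorem Measure.pi_withDensity {ι : Type*} [Fintype ι] {E : ι → Type*}
    [∀ i, MeasurableSpace (E i)] (ν : (i : ι) → Measure (E i)) [∀ i, IsProbabilityMeasure (ν i)]
    (f : (i : ι) → E i → ENNReal) (hf : ∀ i, Measurable (f i))
    [∀ i, SigmaFinite ((ν i).withDensity (f i))] :
    Measure.pi (fun i => (ν i).withDensity (f i)) =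
      (Measure.pi ν).withDensity fun x => ∏ i, f i (x i) := by
  refine Measure.pi_eq fun s hs => ?_
  rw [withDensity_apply _ (MeasurableSet.univ_pi hs),
    ← lintegral_indicator (MeasurableSet.univ_pi hs)]
  have h1 : ((Set.univ.pi s).indicator fun x : (i : ι) → E i => ∏ i, f i (x i)) =
      fun x => ∏ i, (s i).indicator (f i) (x i) := by
    ext x
    by_cases hx : x ∈ Set.univ.pi s
    · rw [Set.indicator_of_mem hx]
      exact Finset.prod_congr rfl fun i _ => (Set.indicator_of_mem (hx i (Set.mem_univ i)) _).symm
    · rw [Set.indicator_of_notMem hx]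
      obtain ⟨i, hi⟩ : ∃ i, x i ∉ s i := by simpa [Set.mem_pi] using hx
      exact (Finset.prod_eq_zero (Finset.mem_univ i) (Set.indicator_of_notMem hi _)).symm
  have hm : ∀ i, Measurable ((s i).indicator (f i)) := fun i => (hf i).indicator (hs i)
  have h2 := lintegral_prod_eq_prod_lintegral_of_indepFun (μ := Measure.pi ν) Finset.univ
    (fun i (x : (i : ι) → E i) => (s i).indicator (f i) (x i))
    (iIndepFun_pi (X := fun i => (s i).indicator (f i)) fun i => (hm i).aemeasurable)
    (fun i => (hm i).comp (measurable_pi_apply i))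
  rw [h1, h2]
  refine Finset.prod_congr rfl fun i _ => ?_
  rw [withDensity_apply _ (hs i), ← lintegral_indicator (hs i)]
  exact (measurePreserving_eval ν i).lintegral_comp (hm i)

/-- The log-likelihoods of the coordinates are independent Gaussians, so they add up and so do their
variances. -/
theorem IsGaussianShift.pi {ι E : Type*} [Fintype ι] [MeasurableSpace E] [Add E] [MeasurableAdd E]
    {γ : Measure E} [IsProbabilityMeasure γ] {a : ι → E} {r : ι → ℝ≥0}
    (h : ∀ i, IsGaussianShift γ (a i) (r i)) :
    IsGaussianShift (Measure.pi fun _ : ι => γ) a (∑ i, r i) := by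
  choose ℓ hℓ hlaw hdens using h
  refine ⟨fun x => ∑ i, ℓ i (x i), by fun_prop, ?_, ?_⟩
  · apply Measure.ext_of_charFun
    have hind := iIndepFun_pi (μ := fun _ : ι => γ) (X := ℓ) fun i => (hℓ i).aemeasurable
    rw [hind.charFun_map_fun_sum_eq_prod (X := fun i (x : ι → E) => ℓ i (x i))
      (fun i => ((hℓ i).comp (measurable_pi_apply i)).aemeasurable)]
    ext t
    have hi : ∀ i, (Measure.pi fun _ : ι => γ).map (fun x => ℓ i (x i)) = gaussianReal 0 (r i) := by
      intro i
      have hi := Measure.map_map (μ := Measure.pi fun _ : ι => γ) (hℓ i) (measurable_pi_apply i)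
      rw [(measurePreserving_eval (fun _ : ι => γ) i).map_eq, hlaw i] at hi
      exact hi.symm
    simp only [hi, Finset.prod_apply, charFun_gaussianReal, ← Complex.exp_sum]
    congr 1
    simp [← Finset.sum_div, Finset.sum_mul, Finset.sum_neg_distrib]
  · have hp : ∀ i, IsProbabilityMeasure
        (γ.withDensity fun y => ENNReal.ofReal (Real.exp (ℓ i y - r i / 2))) := fun i => by
      rw [← hdens i]
      exact Measure.isProbabilityMeasure_map (measurable_add_const _).aemeasurable
    have hmap : ∀ i, IsProbabilityMeasure (γ.map fun y => y + a i) := fun i =>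
      Measure.isProbabilityMeasure_map (measurable_add_const _).aemeasurable
    have h1 := Measure.pi_map_pi (μ := fun _ : ι => γ) (f := fun i (y : E) => y + a i)
      (fun i => (measurable_add_const (a i)).aemeasurable)
    have h2 : (fun x : ι → E => x + a) = fun x i => x i + a i := rfl
    rw [h2, h1]
    simp only [hdens]
    rw [Measure.pi_withDensity (fun _ : ι => γ) _ (by fun_prop)]
    congr 1
    ext x
    rw [← ENNReal.ofReal_prod_of_nonneg (fun i _ => (Real.exp_pos _).le), ← Real.exp_sum]
    simp [Finset.sum_sub_distrib, Finset.sum_div]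

/-- In an orthonormal basis this is a product of one-dimensional shifts; Parseval sums their
variances to `‖a‖²`. -/
theorem isGaussianShift_stdGaussian {E : Type*} [NormedAddCommGroup E] [InnerProductSpace ℝ E]
    [FiniteDimensional ℝ E] [MeasurableSpace E] [BorelSpace E] (a : E) :
    IsGaussianShift (stdGaussian E) a (‖a‖₊ ^ 2) := by
  set b := stdOrthonormalBasis ℝ E
  have h := IsGaussianShift.pi fun i => isGaussianShift_gaussianReal (inner ℝ (b i) a)
  have hr : ∑ i, ‖inner ℝ (b i) a‖₊ ^ 2 = ‖a‖₊ ^ 2 := by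
    ext
    push_cast
    exact b.sum_sq_norm_inner_right a
  rw [hr] at h
  refine h.map (g := fun y i => inner ℝ (b i) y) (by fun_prop) (by fun_prop) ?_ ?_
  · intro x
    ext i
    have := b.orthonormal.inner_right_fintype x i
    simpa using this
  · intro x
    simp only [Pi.add_apply, add_smul, Finset.sum_add_distrib]
    exact congrArg _ (b.sum_repr' a)

/-! ### Hockey-stick functionals of Gaussian shifts -/

theorem integrable_exp_sub_gaussianReal (v : ℝ≥0) (c : ℝ) :
    Integrable (fun g => Real.exp (g - c)) (gaussianReal 0 v) := by
  simpa [Real.exp_sub] using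
    (integrable_exp_mul_gaussianReal (μ := 0) (v := v) 1).div_const (Real.exp c)

theorem integral_exp_sub_gaussianReal (v : ℝ≥0) :
    ∫ g, Real.exp (g - v / 2) ∂gaussianReal 0 v = 1 := by
  have h := congrFun (mgf_fun_id_gaussianReal (μ := 0) (v := v)) 1
  simp only [mgf, one_mul, zero_add, one_pow, mul_one] at h
  simp [Real.exp_sub, integral_div, h]

/-- The expectation of `(x L - c)⁺`, where `log L` has the law `N(-v/2, v)` of the log-likelihood
of a Gaussian shift of variance `v`. -/
noncomputable def hockeyStick (c : ℝ) (v : ℝ≥0) (x : ℝ) : ℝ :=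
  ∫ g, max (x * Real.exp (g - v / 2) - c) 0 ∂gaussianReal 0 v

theorem integrable_hockeyStick (c : ℝ) (v : ℝ≥0) (x : ℝ) :
    Integrable (fun g => max (x * Real.exp (g - v / 2) - c) 0) (gaussianReal 0 v) :=
  (((integrable_exp_sub_gaussianReal v _).const_mul x).sub (integrable_const c)).pos_part

theorem hockeyStick_zero (c x : ℝ) : hockeyStick c 0 x = max (x - c) 0 := by
  simp [hockeyStick]

theorem le_hockeyStick (c : ℝ) (v : ℝ≥0) (x : ℝ) : max (x - c) 0 ≤ hockeyStick c v x := by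
  refine max_le ?_ (integral_nonneg fun g => le_max_right _ _)
  calc x - c = ∫ g, (x * Real.exp (g - v / 2) - c) ∂gaussianReal 0 v := by
        rw [integral_sub ((integrable_exp_sub_gaussianReal v _).const_mul x) (integrable_const c),
          integral_const_mul, integral_exp_sub_gaussianReal]
        simp
    _ ≤ hockeyStick c v x := integral_mono
        (((integrable_exp_sub_gaussianReal v _).const_mul x).sub (integrable_const c))
        (integrable_hockeyStick c v x) fun g => le_max_left _ _

theorem abs_hockeyStick_sub_le (c : ℝ) (v : ℝ≥0) (x y : ℝ) :
    |hockeyStick c v x - hockeyStick c v y| ≤ |x - y| := by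
  unfold hockeyStick
  rw [← integral_sub (integrable_hockeyStick c v x) (integrable_hockeyStick c v y)]
  refine (abs_integral_le_integral_abs).trans ?_
  calc _ ≤ ∫ g, |x - y| * Real.exp (g - v / 2) ∂gaussianReal 0 v := by
        refine integral_mono
          ((integrable_hockeyStick c v x).sub (integrable_hockeyStick c v y)).abs
          ((integrable_exp_sub_gaussianReal v _).const_mul _) fun g => ?_
        refine (abs_max_sub_max_le_abs _ _ _).trans_eq ?_
        rw [sub_sub_sub_cancel_right, ← sub_mul, abs_mul, abs_of_pos (Real.exp_pos _)]
    _ = |x - y| := by rw [integral_const_mul, integral_exp_sub_gaussianReal, mul_one]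

theorem continuous_hockeyStick (c : ℝ) (v : ℝ≥0) : Continuous (hockeyStick c v) :=
  (LipschitzWith.of_dist_le_mul (K := 1) fun x y => by
    simpa [Real.dist_eq] using abs_hockeyStick_sub_le c v x y).continuous

theorem Integrable.hockeyStick {α : Type*} [MeasurableSpace α] {γ : Measure α}
    [IsFiniteMeasure γ] (c : ℝ) (v : ℝ≥0) {f : α → ℝ} (hf : Integrable f γ) :
    Integrable (fun a => hockeyStick c v (f a)) γ := by
  refine Integrable.mono' ((integrable_const |_root_.hockeyStick c v 0|).add hf.abs)
    ((continuous_hockeyStick c v).comp_aestronglyMeasurable hf.1) (ae_of_all _ fun a => ?_)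
  have := abs_hockeyStick_sub_le c v (f a) 0
  have h2 := abs_sub_abs_le_abs_sub (_root_.hockeyStick c v (f a)) (_root_.hockeyStick c v 0)
  simp only [Real.norm_eq_abs, Pi.add_apply, sub_zero] at *
  linarith

/-- Semigroup property: the sum of independent `N(0, r)` and `N(0, v)` variables is `N(0, r + v)`.
This is the composition rule for two rounds. -/
theorem integral_hockeyStick (c : ℝ) (v r : ℝ≥0) (x : ℝ) :
    ∫ g, hockeyStick c v (x * Real.exp (g - r / 2)) ∂gaussianReal 0 r =
      hockeyStick c (r + v) x := by
  have hint := integrable_hockeyStick c (r + v) x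
  have h : gaussianReal 0 (r + v) =
      ((gaussianReal 0 r).prod (gaussianReal 0 v)).map fun p => p.1 + p.2 := by
    have := gaussianReal_conv_gaussianReal (m₁ := 0) (m₂ := 0) (v₁ := r) (v₂ := v)
    rw [add_zero] at this
    exact this.symm
  unfold hockeyStick
  rw [h] at hint ⊢
  rw [integral_map (by fun_prop) hint.1]
  replace hint := hint.comp_measurable (f := fun p : ℝ × ℝ => p.1 + p.2) (by fun_prop)
  simp only [Function.comp_def] at hint
  rw [integral_prod _ hint]
  congr! 5 with g g'
  rw [mul_assoc, ← Real.exp_add]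
  push_cast
  ring_nf

/-- Semigroup property combined with the Jensen bound `le_hockeyStick`. -/
theorem hockeyStick_le_add (c : ℝ) (v r : ℝ≥0) (x : ℝ) :
    hockeyStick c v x ≤ hockeyStick c (v + r) x := by
  rw [← integral_hockeyStick]
  refine integral_mono (integrable_hockeyStick c v x) ?_ fun g => le_hockeyStick c r _
  exact Integrable.hockeyStick c r ((integrable_exp_sub_gaussianReal v _).const_mul x)

theorem hockeyStick_mono (c x : ℝ) : Monotone fun v => hockeyStick c v x := by
  intro v w h
  obtain ⟨r, rfl⟩ := exists_add_of_le h
  exact hockeyStick_le_add c v r x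

/-! ### Adaptive composition over the rounds -/

theorem integrable_of_mem_unitInterval {Ω : Type*} [MeasurableSpace Ω] {P : Measure Ω}
    [IsFiniteMeasure P] {φ : Ω → ℝ} (hφ : Measurable φ) (h : ∀ ω, 0 ≤ φ ω ∧ φ ω ≤ 1) :
    Integrable φ P :=
  (integrable_const (1 : ℝ)).mono' hφ.aestronglyMeasurable (ae_of_all _ fun ω => by
    rw [Real.norm_of_nonneg (h ω).1]; exact (h ω).2)

theorem measurable_finCons {α E : Type*} [MeasurableSpace α] [MeasurableSpace E] {K : ℕ}
    {f : α → E} {g : α → Fin K → E} (hf : Measurable f) (hg : Measurable g) :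
    Measurable fun a => (Fin.cons (f a) (g a) : Fin (K + 1) → E) := by
  refine measurable_pi_lambda _ fun k => ?_
  refine Fin.cases ?_ (fun j => ?_) k
  · simpa using hf
  · simpa using measurable_pi_iff.1 hg j

theorem integral_pi_finSucc {E : Type*} [MeasurableSpace E] (γ : Measure E)
    [IsProbabilityMeasure γ] {K : ℕ} {f : (Fin (K + 1) → E) → ℝ}
    (hf : Integrable f (Measure.pi fun _ => γ)) :
    ∫ z, f z ∂(Measure.pi fun _ => γ) =
      ∫ y, ∫ z : Fin K → E, f (Fin.cons y z) ∂(Measure.pi fun _ => γ) ∂γ := by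
  have hmp := (measurePreserving_piFinSuccAbove (fun _ : Fin (K + 1) => γ) 0).symm
  rw [← hmp.integral_comp']
  refine (integral_prod _ ((hmp.integrable_comp_emb
    (MeasurableEquiv.measurableEmbedding _)).2 hf)).trans ?_
  congr! 4 with y z
  exact congrArg f (Fin.insertNth_zero' y z)

/-- The displacement of each coordinate depends only on the preceding coordinates. -/
def IsAdaptedShift {E : Type*} {K : ℕ} (v : Fin K → (Fin K → E) → E) : Prop :=
  ∀ k z z', (∀ j < k, z j = z' j) → v k z = v k z'

/-- Induction on the number of rounds, splitting off the first. The factor `x` is there for the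
induction: it carries the likelihood ratio accumulated so far. -/
theorem integral_adaptedShift_sub_le {E : Type*} [MeasurableSpace E] [AddGroup E]
    [MeasurableAdd₂ E] [MeasurableSub E] (γ : Measure E) [IsProbabilityMeasure γ] (s : ℝ≥0) (c : ℝ)
    {K : ℕ} (v : Fin K → (Fin K → E) → E) (hv : ∀ k, Measurable (v k)) (hadapt : IsAdaptedShift v)
    (hshift : ∀ k z, ∃ r ≤ s, IsGaussianShift γ (v k z) r)
    (ψ : (Fin K → E) → ℝ) (hψ : Measurable ψ) (hψ01 : ∀ z, 0 ≤ ψ z ∧ ψ z ≤ 1) (x : ℝ) :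
    x * ∫ z, ψ (fun k => z k + v k z) ∂(Measure.pi fun _ => γ) -
      c * ∫ z, ψ z ∂(Measure.pi fun _ => γ) ≤ hockeyStick c (K * s) x := by
  induction K generalizing x with
  | zero =>
    have h : ∀ z, ψ z = ψ 0 := fun z => by rw [Subsingleton.elim z 0]
    simp only [h, integral_const, probReal_univ, one_smul, Nat.cast_zero, zero_mul,
      hockeyStick_zero]
    rw [← sub_mul]
    calc (x - c) * ψ 0 ≤ max (x - c) 0 * ψ 0 :=
          mul_le_mul_of_nonneg_right (le_max_left _ _) (hψ01 0).1
      _ ≤ max (x - c) 0 := mul_le_of_le_one_right (le_max_right _ _) (hψ01 0).2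
  | succ K ih =>
    set a := v 0 0
    have hv0 : ∀ z, v 0 z = a := fun z => hadapt 0 z 0 fun j hj => absurd hj (Fin.not_lt_zero j)
    -- Here `y` is the first coordinate after translation, so `y - a` recovers the original one, on
    -- which the later displacements depend.
    let w : E → Fin K → (Fin K → E) → E := fun y k z => v k.succ (Fin.cons (y - a) z)
    have hw_joint : ∀ k, Measurable fun p : E × (Fin K → E) => w p.1 k p.2 := fun k =>
      (hv _).comp (measurable_finCons (measurable_fst.sub_const a) measurable_snd)
    have hw : ∀ y k, Measurable (w y k) := fun y k => (hw_joint k).comp measurable_prodMk_left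
    have hw_adapt : ∀ y, IsAdaptedShift (w y) := by
      intro y k z z' h
      refine hadapt _ _ _ fun j hj => ?_
      induction j using Fin.cases with
      | zero => simp
      | succ j => simpa using h j (Fin.succ_lt_succ_iff.1 hj)
    let p : E → ℝ := fun y => ∫ z, ψ (Fin.cons y z) ∂(Measure.pi fun _ => γ)
    let q : E → ℝ := fun y => ∫ z, ψ (Fin.cons y fun k => z k + w y k z) ∂(Measure.pi fun _ => γ)
    have hp_joint : Measurable fun t : E × (Fin K → E) => ψ (Fin.cons t.1 t.2) :=
      hψ.comp (measurable_finCons measurable_fst measurable_snd)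
    have hq_joint : Measurable fun t : E × (Fin K → E) =>
        ψ (Fin.cons t.1 fun k => t.2 k + w t.1 k t.2) :=
      hψ.comp (measurable_finCons measurable_fst (measurable_pi_lambda _ fun k =>
        ((measurable_pi_apply k).comp measurable_snd).add (hw_joint k)))
    have hp : Measurable p := hp_joint.stronglyMeasurable.integral_prod_right.measurable
    have hq : Measurable q := hq_joint.stronglyMeasurable.integral_prod_right.measurable
    have int01 : ∀ f : (Fin K → E) → ℝ, Measurable f → (∀ z, 0 ≤ f z ∧ f z ≤ 1) →
        0 ≤ ∫ z, f z ∂(Measure.pi fun _ => γ) ∧ ∫ z, f z ∂(Measure.pi fun _ => γ) ≤ 1 := by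
      intro f hf h
      refine ⟨integral_nonneg fun z => (h z).1, ?_⟩
      simpa using integral_mono (integrable_of_mem_unitInterval hf h)
        (integrable_const (μ := Measure.pi fun _ => γ) (1 : ℝ)) fun z => (h z).2
    have hp01 : ∀ y, 0 ≤ p y ∧ p y ≤ 1 := fun y =>
      int01 _ (hp_joint.comp measurable_prodMk_left) fun z => hψ01 _
    have hq01 : ∀ y, 0 ≤ q y ∧ q y ≤ 1 := fun y =>
      int01 _ (hq_joint.comp measurable_prodMk_left) fun z => hψ01 _
    have hψ_shift : Measurable fun z : Fin (K + 1) → E => ψ fun k => z k + v k z :=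
      hψ.comp (measurable_pi_lambda _ fun k => (measurable_pi_apply k).add (hv k))
    obtain ⟨r, hr, ℓ, hℓ, hlaw, hdens⟩ := hshift 0 0
    have hQ : ∫ z, ψ (fun k => z k + v k z) ∂(Measure.pi fun _ => γ) =
        ∫ y, Real.exp (ℓ y - r / 2) * q y ∂γ := by
      rw [integral_pi_finSucc γ (integrable_of_mem_unitInterval hψ_shift fun z => hψ01 _)]
      calc _ = ∫ y, q (y + a) ∂γ := by
            congr! 4 with y z
            congr 1
            ext k
            refine Fin.cases ?_ (fun k => ?_) k
            · simp [hv0]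
            · simp [w]
        _ = ∫ y, q y ∂(γ.map fun y => y + a) :=
            (integral_map (measurable_add_const a).aemeasurable hq.aestronglyMeasurable).symm
        _ = _ := by
            rw [hdens, integral_withDensity_eq_integral_toReal_smul (by fun_prop)
              (ae_of_all _ fun _ => ENNReal.ofReal_lt_top)]
            simp [ENNReal.toReal_ofReal (Real.exp_pos _).le]
    have hexp : Integrable (fun y => Real.exp (ℓ y - r / 2)) γ := by
      have := integrable_exp_sub_gaussianReal r (r / 2)
      rw [← hlaw] at this
      exact this.comp_measurable hℓ
    have hexpq : Integrable (fun y => Real.exp (ℓ y - r / 2) * q y) γ :=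
      hexp.mono' ((by fun_prop : Measurable _).aestronglyMeasurable) (ae_of_all _ fun y => by
        rw [norm_mul, Real.norm_of_nonneg (Real.exp_pos _).le, Real.norm_of_nonneg (hq01 y).1]
        exact mul_le_of_le_one_right (Real.exp_pos _).le (hq01 y).2)
    have hpint := integrable_of_mem_unitInterval (P := γ) hp hp01
    rw [hQ, integral_pi_finSucc γ (integrable_of_mem_unitInterval hψ hψ01), ← integral_const_mul,
      ← integral_const_mul, ← integral_sub (hexpq.const_mul x) (hpint.const_mul c)]
    -- With the first coordinate fixed at `y`, the induction hypothesis applies to the remaining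
    -- rounds, with `x` multiplied by the likelihood ratio at `y`.
    calc _ ≤ ∫ y, hockeyStick c (K * s) (x * Real.exp (ℓ y - r / 2)) ∂γ := by
          refine integral_mono ((hexpq.const_mul x).sub (hpint.const_mul c))
            (Integrable.hockeyStick c _ (hexp.const_mul x)) fun y => ?_
          have := ih (w y) (hw y) (hw_adapt y) (fun k z => hshift _ _)
            (fun z => ψ (Fin.cons y z)) (hp_joint.comp measurable_prodMk_left) (fun z => hψ01 _)
            (x * Real.exp (ℓ y - r / 2))
          simpa only [mul_assoc] using this
      _ = hockeyStick c (r + K * s) x := by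
          rw [← integral_hockeyStick, ← hlaw, integral_map hℓ.aemeasurable]
          exact ((continuous_hockeyStick c _).comp (by fun_prop)).aestronglyMeasurable
      _ ≤ hockeyStick c ((K + 1 : ℕ) * s) x := by
          refine hockeyStick_mono c x ?_
          push_cast
          rw [add_mul, one_mul, add_comm r]
          gcongr

/-! ### From hockey-stick bounds to trade-off functions -/

theorem continuous_cdf_of_noAtoms (P : Measure ℝ) [IsProbabilityMeasure P]
    (h : ∀ x, P {x} = 0) : Continuous (cdf P) := by
  refine continuous_iff_continuousAt.2 fun x => ?_
  rw [(monotone_cdf P).continuousAt_iff_leftLim_eq_rightLim, (cdf P).rightLim_eq]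
  have h1 := (cdf P).measure_singleton x
  rw [measure_cdf, h x, eq_comm, ENNReal.ofReal_eq_zero] at h1
  exact le_antisymm ((monotone_cdf P).leftLim_le le_rfl) (by linarith)

theorem exists_cdf_eq (P : Measure ℝ) [IsProbabilityMeasure P] (h : ∀ x, P {x} = 0) {p : ℝ}
    (hp0 : 0 < p) (hp1 : p < 1) : ∃ x, cdf P x = p := by
  obtain ⟨a, ha⟩ := ((tendsto_cdf_atBot P).eventually_lt_const hp0).exists
  obtain ⟨b, hb⟩ := ((tendsto_cdf_atTop P).eventually_const_lt hp1).exists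
  exact mem_range_of_exists_le_of_exists_ge (continuous_cdf_of_noAtoms P h) ⟨a, ha.le⟩ ⟨b, hb.le⟩

theorem gaussCDF_coe (x : ℝ) : gaussCDF x = cdf (gaussianReal 0 1) x := by
  rw [cdf_eq_real, gaussCDF]
  congr 1
  ext t
  simp

theorem gaussCDF_mono : Monotone gaussCDF := fun _ _ h =>
  measureReal_mono fun _ ht => le_trans (Set.mem_ofPred.1 ht) h

theorem gaussCDF_bot : gaussCDF ⊥ = 0 := by
  simp [gaussCDF]

theorem gaussQuantile_cdf_le (x : ℝ) : gaussQuantile (cdf (gaussianReal 0 1) x) ≤ x :=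
  sInf_le (gaussCDF_coe x).ge

theorem gaussQuantile_zero : gaussQuantile 0 = ⊥ :=
  le_bot_iff.1 (sInf_le gaussCDF_bot.ge)

/-- The value of the hockey-stick divergence at the likelihood ratio attained at the point `x`. -/
theorem hockeyStick_gaussian {t : ℝ} (ht : 0 < t) (x : ℝ) :
    hockeyStick (Real.exp (t * x - t ^ 2 / 2)) (‖t‖₊ ^ 2) 1 =
      (1 - cdf (gaussianReal 0 1) (x - t)) -
        Real.exp (t * x - t ^ 2 / 2) * (1 - cdf (gaussianReal 0 1) x) := by
  have hlaw : gaussianReal 0 (‖t‖₊ ^ 2) = (gaussianReal 0 1).map fun y => t * y := by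
    rw [gaussianReal_map_const_mul]
    congr 1
    · simp
    · ext; simp
  have hIoi : ∀ y, (gaussianReal 0 1).real (Set.Ioi y) = 1 - cdf (gaussianReal 0 1) y := by
    intro y
    rw [cdf_eq_real, ← Set.compl_Iic, probReal_compl_eq_one_sub measurableSet_Iic]
  have hexp : Integrable (fun y => Real.exp (t * y - t ^ 2 / 2)) (gaussianReal 0 1) := by
    simpa only [Real.exp_sub] using (integrable_exp_mul_gaussianReal t).div_const _
  have hmeas : ∫ y in Set.Ioi x, Real.exp (t * y - t ^ 2 / 2) ∂gaussianReal 0 1 =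
      1 - cdf (gaussianReal 0 1) (x - t) := by
    rw [← hIoi, integral_eq_lintegral_of_nonneg_ae (ae_of_all _ fun _ => (Real.exp_pos _).le)
      (by fun_prop), ← withDensity_apply _ measurableSet_Ioi, ← gaussianReal_map_add_eq_withDensity,
      Measure.map_apply (measurable_add_const t) measurableSet_Ioi, measureReal_def]
    congr 2
    ext y
    simp [sub_lt_iff_lt_add]
  -- The likelihood ratio increases with `y` because `t > 0`, so it exceeds its value at `x` exactly
  -- on `(x, ∞)`.
  have hmax : ∀ y, max (1 * Real.exp (t * y - ((‖t‖₊ ^ 2 : ℝ≥0) : ℝ) / 2) -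
      Real.exp (t * x - t ^ 2 / 2)) 0 = (Set.Ioi x).indicator
        (fun y => Real.exp (t * y - t ^ 2 / 2) - Real.exp (t * x - t ^ 2 / 2)) y := by
    intro y
    simp only [NNReal.coe_pow, coe_nnnorm, Real.norm_eq_abs, sq_abs, one_mul]
    by_cases hy : x < y
    · rw [Set.indicator_of_mem (Set.mem_Ioi.2 hy), max_eq_left]
      rw [sub_nonneg, Real.exp_le_exp]
      nlinarith
    · rw [Set.indicator_of_notMem (by simpa using hy), max_eq_right]
      rw [sub_nonpos, Real.exp_le_exp]
      nlinarith
  rw [hockeyStick, hlaw, integral_map (by fun_prop) (by fun_prop)]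
  simp only [hmax]
  rw [integral_indicator measurableSet_Ioi, integral_sub hexp.integrableOn (integrable_const _),
    hmeas, setIntegral_const, hIoi, smul_eq_mul, mul_comm]

/-- Domination of all hockey-stick divergences by the Gaussian ones implies domination of the
trade-off function. -/
theorem le_tradeoff_of_hockeyStick {Ω : Type*} [MeasurableSpace Ω] {P Q : Measure Ω}
    [IsProbabilityMeasure P] [IsProbabilityMeasure Q] {t : ℝ} (ht : 0 < t)
    (h : ∀ c φ, Measurable φ → (∀ ω, 0 ≤ φ ω ∧ φ ω ≤ 1) →
      ∫ ω, φ ω ∂Q - c * ∫ ω, φ ω ∂P ≤ hockeyStick c (‖t‖₊ ^ 2) 1)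
    {α : ℝ} (hα0 : 0 < α) (hα1 : α ≤ 1) :
    gaussCDF (gaussQuantile (1 - α) - (t : EReal)) ≤ tradeoff α P Q := by
  refine le_csInf ⟨1, fun _ => 0, measurable_const, by simp, by simpa using hα0.le, by simp⟩ ?_
  rintro β ⟨φ, hφ, hφ01, hP, rfl⟩
  rcases hα1.eq_or_lt with rfl | hα1
  · rw [sub_self, gaussQuantile_zero, EReal.bot_sub, gaussCDF_bot, sub_nonneg]
    simpa using integral_mono (integrable_of_mem_unitInterval hφ hφ01)
      (integrable_const (μ := Q) (1 : ℝ)) fun z => (hφ01 z).2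
  · have hatom : ∀ x, gaussianReal 0 1 {x} = 0 := fun x =>
      gaussianReal_absolutelyContinuous 0 one_ne_zero (by simp)
    obtain ⟨x, hx⟩ := exists_cdf_eq (gaussianReal 0 1) hatom (p := 1 - α) (by linarith)
      (by linarith)
    -- The constant is the Neyman–Pearson critical value: the likelihood ratio at the point `x`
    -- where the Gaussian test has level `α`.
    have h1 := h (Real.exp (t * x - t ^ 2 / 2)) φ hφ hφ01
    rw [hockeyStick_gaussian ht, hx] at h1
    have h2 := mul_le_mul_of_nonneg_left hP (Real.exp_pos (t * x - t ^ 2 / 2)).le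
    calc gaussCDF (gaussQuantile (1 - α) - (t : EReal))
        ≤ gaussCDF ((x - t : ℝ) : EReal) := by
          refine gaussCDF_mono ?_
          rw [← hx, EReal.coe_sub]
          exact EReal.sub_le_sub (gaussQuantile_cdf_le x) le_rfl
      _ = cdf (gaussianReal 0 1) (x - t) := gaussCDF_coe _
      _ ≤ 1 - ∫ ω, φ ω ∂Q := by linarith

/-! ### Noise displacements for FedSGD -/

namespace FedSGD

variable {X : Type*} {d m : ℕ} {n : Fin m → ℕ}

theorem iterates_succ (A : FedSGD X d m) (D : FedData n X) (z : A.Noise) (k : Fin A.K) :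
    A.iterates D z k.succ = A.iterates D z k.castSucc -
      A.eta • ∑ i, A.w i • A.noisyGrad D z k i (A.iterates D z k.castSucc) := rfl

theorem iterates_congr (A : FedSGD X d m) (D : FedData n X) {z z' : A.Noise} (k : Fin (A.K + 1))
    (h : ∀ j : Fin A.K, j.castSucc < k → z j = z' j) : A.iterates D z k = A.iterates D z' k := by
  induction k using Fin.induction with
  | zero => rfl
  | succ k ih =>
    have hk := ih fun j hj => h j (hj.trans (Fin.castSucc_lt_succ (i := k)))
    simp only [iterates_succ, noisyGrad, hk, h k Fin.castSucc_lt_succ]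

instance (A : FedSGD X d m) : IsProbabilityMeasure A.noiseLaw := by
  unfold noiseLaw; infer_instance

theorem measurable_clientGrad (A : FedSGD X d m) (D : FedData n X) (i : Fin m) :
    Measurable (A.clientGrad D i) :=
  Measurable.fun_const_smul (Finset.measurable_sum _ fun _ _ => measurable_gradient _) _

/-- Only the weighted sum of the messages moves the parameter, so only that sum has to match. The
case `K = 0` is exempted because the noise scales then vanish although the gradients may differ. -/
theorem iterates_shift (A : FedSGD X d m) {D D' : FedData n X}
    {a : EuclideanSpace ℝ (Fin d) → Fin m → EuclideanSpace ℝ (Fin d)}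
    (ha : A.K ≠ 0 → ∀ θ, ∑ i, A.w i • (A.clientGrad D i θ + A.sigma i • a θ i) =
      ∑ i, A.w i • A.clientGrad D' i θ) (z : A.Noise) (k : Fin (A.K + 1)) :
    A.iterates D (fun k => z k + a (A.iterates D' z k.castSucc)) k = A.iterates D' z k := by
  induction k using Fin.induction with
  | zero => rfl
  | succ k ih =>
    simp only [iterates_succ, ih, noisyGrad, Pi.add_apply]
    have := ha (Nat.pos_iff_ne_zero.1 k.pos) (A.iterates D' z k.castSucc)
    simp only [smul_add, Finset.sum_add_distrib] at this ⊢
    rw [← this]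
    simp only [smul_add]
    abel

theorem le_tradeoff_of_shift (A : FedSGD X d m) (D' : FedData n X)
    {a : EuclideanSpace ℝ (Fin d) → Fin m → EuclideanSpace ℝ (Fin d)} (ha : Measurable a)
    {t : ℝ} (ht : 0 < t) (hat : ∀ θ, A.K * ∑ i, ‖a θ i‖ ^ 2 ≤ t ^ 2)
    {Ω : Type*} [MeasurableSpace Ω] {M M' : A.Noise → Ω} (hM : Measurable M) (hM' : Measurable M')
    (hMM' : ∀ z, M (fun k => z k + a (A.iterates D' z k.castSucc)) = M' z)
    {α : ℝ} (hα0 : 0 < α) (hα1 : α ≤ 1) :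
    gaussCDF (gaussQuantile (1 - α) - (t : EReal)) ≤
      tradeoff α (A.noiseLaw.map M) (A.noiseLaw.map M') := by
  have := Measure.isProbabilityMeasure_map (μ := A.noiseLaw) hM.aemeasurable
  have := Measure.isProbabilityMeasure_map (μ := A.noiseLaw) hM'.aemeasurable
  refine le_tradeoff_of_hockeyStick ht (fun c φ hφ hφ01 => ?_) hα0 hα1
  rw [integral_map hM.aemeasurable hφ.aestronglyMeasurable,
    integral_map hM'.aemeasurable hφ.aestronglyMeasurable]
  -- Each round gets the budget `t² / K`; for `K = 0` the quotient is `0`, which is harmless.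
  have h := integral_adaptedShift_sub_le
    (Measure.pi fun _ : Fin m => stdGaussian (EuclideanSpace ℝ (Fin d))) (‖t‖₊ ^ 2 / A.K) c
    (fun k z => a (A.iterates D' z k.castSucc))
    (fun k => ha.comp ((measurable_pi_apply _).comp (A.measurable_iterates D')))
    (fun k z z' hz => congrArg a (A.iterates_congr D' _ fun j hj => hz j hj))
    (fun k z => ⟨_, ?_, IsGaussianShift.pi fun i => isGaussianShift_stdGaussian _⟩)
    (fun z => φ (M z)) (hφ.comp hM) (fun z => hφ01 _) 1
  · simp only [hMM', one_mul] at h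
    refine h.trans (hockeyStick_mono c 1 ?_)
    rcases eq_or_ne (A.K : ℝ≥0) 0 with hK | hK
    · simp [hK]
    · rw [mul_div_cancel₀ _ hK]
  · have hK : (0 : ℝ≥0) < A.K := by exact_mod_cast k.pos
    rw [le_div_iff₀ hK, mul_comm, ← NNReal.coe_le_coe]
    push_cast
    simpa using hat (A.iterates D' z k.castSucc)

/-- Sensitivity of the average gradient of a client to one of its data. -/
theorem norm_clientGrad_sub_le (A : FedSGD X d m) {B : ℝ}
    (hbound : ∀ x θ, ‖gradient (A.loss x) θ‖ ≤ B) {D D' : FedData n X} {s : Fin m} {p : Fin (n s)}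
    (h : ∀ q, q ≠ p → D s q = D' s q) (θ : EuclideanSpace ℝ (Fin d)) :
    ‖A.clientGrad D' s θ - A.clientGrad D s θ‖ ≤ 2 * B / n s := by
  rw [clientGrad, clientGrad, ← smul_sub, ← Finset.sum_sub_distrib, Finset.sum_eq_single p
    (fun q _ hq => by rw [h q hq, sub_self]) (by simp), norm_smul,
    Real.norm_of_nonneg (by positivity), one_div, inv_mul_eq_div]
  gcongr
  calc _ ≤ _ := norm_sub_le _ _
    _ ≤ 2 * B := by linarith [hbound (D s p) θ, hbound (D' s p) θ]

theorem clientGrad_congr (A : FedSGD X d m) {D D' : FedData n X} {i : Fin m} (h : D i = D' i) :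
    A.clientGrad D i = A.clientGrad D' i := by
  ext1 θ
  simp only [clientGrad, h]

theorem isFedGDP_serverView (A : FedSGD X d m) (hn : ∀ i, 1 ≤ n i) {μ B : ℝ} (hμ : 0 < μ)
    (hbound : ∀ x θ, ‖gradient (A.loss x) θ‖ ≤ B)
    (hσ : ∀ i, A.sigma i = 2 * B * √(A.K : ℝ) / (μ * (n i : ℝ))) :
    IsFedGDP μ fun D : FedData n X => A.serverView D := by
  rintro s D D' ⟨p, -, hp⟩ hD α hα0 hα1
  have hB : 0 ≤ B := (norm_nonneg _).trans (hbound (D s p) A.theta0)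
  have hns : (0 : ℝ) < n s := by exact_mod_cast hn s
  have hsens := A.norm_clientGrad_sub_le hbound hp
  -- The server sees every message separately, so the noise of client `s` alone must absorb the
  -- change of its gradient.
  let a : EuclideanSpace ℝ (Fin d) → Fin m → EuclideanSpace ℝ (Fin d) := fun θ =>
    Pi.single s ((A.sigma s)⁻¹ • (A.clientGrad D' s θ - A.clientGrad D s θ))
  have ha : Measurable a := by
    refine measurable_pi_lambda _ fun i => ?_
    by_cases hi : i = s
    · subst hi
      simpa [a] using ((A.measurable_clientGrad D' i).sub
        (A.measurable_clientGrad D i)).fun_const_smul (A.sigma i)⁻¹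
    · simp [a, hi]
  have hcancel : A.K ≠ 0 → ∀ θ i,
      A.clientGrad D i θ + A.sigma i • a θ i = A.clientGrad D' i θ := by
    intro hK θ i
    by_cases hi : i = s
    · subst hi
      -- With `K ≠ 0` a vanishing scale forces `B = 0`, and then there is no gradient change to
      -- absorb.
      by_cases hs : A.sigma i = 0
      · have hB0 : B = 0 := by
          rw [hσ i] at hs
          simpa [hμ.ne', hns.ne', hK] using hs
        have h0 : A.clientGrad D' i θ - A.clientGrad D i θ = 0 :=
          norm_le_zero_iff.1 ((hsens θ).trans_eq (by simp [hB0]))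
        rw [hs, zero_smul, add_zero, ← sub_eq_zero, ← neg_eq_zero, neg_sub, h0]
      · simp [a, smul_inv_smul₀ hs]
    · simp [a, hi, A.clientGrad_congr (hD i hi)]
  have hiter := A.iterates_shift (D := D) (D' := D') (a := a) fun hK θ => by
    simp only [hcancel hK]
  refine A.le_tradeoff_of_shift D' ha hμ (fun θ => ?_) (A.measurable_messages D)
    (A.measurable_messages D') (fun z => ?_) hα0 hα1
  · have hsum : ∑ i, ‖a θ i‖ ^ 2 =
        ((A.sigma s)⁻¹ * ‖A.clientGrad D' s θ - A.clientGrad D s θ‖) ^ 2 := by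
      rw [Finset.sum_eq_single s (fun i _ hi => by simp [a, hi]) (by simp)]
      simp [a, norm_smul, mul_pow]
    rw [hsum]
    have hσs : 0 ≤ A.sigma s := by rw [hσ]; positivity
    -- Outside the degenerate cases `σ_s⁻¹ · 2B / n_s = μ / √K`, which is how the noise scale was
    -- calibrated.
    calc _ ≤ A.K * ((A.sigma s)⁻¹ * (2 * B / n s)) ^ 2 := by gcongr; exact hsens θ
      _ ≤ μ ^ 2 := by
        rw [hσ]
        by_cases hK : (A.K : ℝ) = 0
        · simp [hK, sq_nonneg]
        by_cases hB0 : B = 0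
        · simp [hB0, sq_nonneg]
        have hsq : √(A.K : ℝ) ^ 2 = A.K := Real.sq_sqrt (Nat.cast_nonneg _)
        have hsq0 : √(A.K : ℝ) ≠ 0 := fun h => hK (by rw [← hsq, h]; simp)
        refine le_of_eq ?_
        nth_rewrite 1 [← hsq]
        field_simp
  · ext1 k
    ext1 i
    rw [messages, messages, hiter z, noisyGrad, noisyGrad,
      ← hcancel (Nat.pos_iff_ne_zero.1 k.pos), Pi.add_apply, smul_add]
    abel

theorem isGDP_thirdPartyView (A : FedSGD X d m) (hn : ∀ i, 1 ≤ n i) {μ B : ℝ} (hμ : 0 < μ)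
    (hbound : ∀ x θ, ‖gradient (A.loss x) θ‖ ≤ B)
    (hσ : ∀ i, A.sigma i = 2 * B * √(A.K : ℝ) / (μ * (n i : ℝ)))
    (hw : ∀ i, A.w i = (n i : ℝ) / ∑ j, (n j : ℝ)) :
    IsGDP (μ / √(m : ℝ))
      fun D : ((i : Fin m) × Fin (n i)) → X => A.thirdPartyView fun i j => D ⟨i, j⟩ := by
  rintro E E' ⟨⟨s, p⟩, -, hp⟩ α hα0 hα1
  set D : FedData n X := fun i j => E ⟨i, j⟩
  set D' : FedData n X := fun i j => E' ⟨i, j⟩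
  have hB : 0 ≤ B := (norm_nonneg _).trans (hbound (D s p) A.theta0)
  have hpos : ∀ i, (0 : ℝ) < n i := fun i => by exact_mod_cast hn i
  have hm : (0 : ℝ) < m := by exact_mod_cast s.pos
  set N : ℝ := ∑ j, (n j : ℝ)
  have hN0 : 0 < N := Finset.sum_pos (fun i _ => hpos i) ⟨s, Finset.mem_univ s⟩
  have hsens := A.norm_clientGrad_sub_le hbound (D := D) (D' := D') (s := s) (p := p)
    fun q hq => hp _ (by simpa using hq)
  have hD : ∀ i, i ≠ s → A.clientGrad D i = A.clientGrad D' i := fun i hi =>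
    A.clientGrad_congr (funext fun j => hp _ fun h => hi (congrArg Sigma.fst h))
  let δ : EuclideanSpace ℝ (Fin d) → EuclideanSpace ℝ (Fin d) := fun θ =>
    A.w s • (A.clientGrad D' s θ - A.clientGrad D s θ)
  have hδ : ∀ θ, ‖δ θ‖ ≤ 2 * B / N := fun θ => by
    have hws : 0 ≤ A.w s := by rw [hw]; positivity
    rw [norm_smul, Real.norm_of_nonneg hws]
    calc _ ≤ A.w s * (2 * B / n s) := by gcongr; exact hsens θ
      _ = 2 * B / N := by
        have := (hpos s).ne'
        rw [hw]; field_simp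
  -- The weights `n_i / N` cancel the `1 / n_i` in the noise scales, so all clients contribute noise
  -- of the same scale `c` to the sum.
  let c : ℝ := 2 * B * √(A.K : ℝ) / (μ * N)
  have hc : ∀ i, A.w i * A.sigma i = c := fun i => by
    have := (hpos i).ne'
    rw [hw, hσ]; simp only [c]; field_simp
  -- An even split gives the least total squared length with weighted sum `δ θ`, namely `m (‖δ θ‖ /
  -- (m c))² = ‖δ θ‖² / (m c²)` when `c ≠ 0`.
  let a : EuclideanSpace ℝ (Fin d) → Fin m → EuclideanSpace ℝ (Fin d) := fun θ _ =>
    (m * c)⁻¹ • δ θ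
  have ha : Measurable a := measurable_pi_lambda _ fun _ =>
    (((A.measurable_clientGrad D' s).sub
      (A.measurable_clientGrad D s)).fun_const_smul _).fun_const_smul _
  have hcancel : A.K ≠ 0 → ∀ θ, ((m : ℝ) * c) • ((m * c)⁻¹ • δ θ) = δ θ := by
    intro hK θ
    by_cases hc0 : c = 0
    · have hB0 : B = 0 := by simpa [c, hμ.ne', hN0.ne', hK] using hc0
      have h0 : δ θ = 0 := norm_le_zero_iff.1 ((hδ θ).trans_eq (by simp [hB0]))
      simp [h0]
    · exact smul_inv_smul₀ (mul_ne_zero hm.ne' hc0) _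
  have hiter := A.iterates_shift (D := D) (D' := D') (a := a) fun hK θ => by
    have h1 : ∑ i, A.w i • A.sigma i • a θ i = δ θ := by
      simp only [smul_smul, ← mul_assoc, hc, a]
      rw [Finset.sum_const, Finset.card_univ, Fintype.card_fin, ← Nat.cast_smul_eq_nsmul ℝ,
        smul_smul, ← mul_assoc, ← smul_smul, hcancel hK]
    have h2 : ∑ i, A.w i • A.clientGrad D' i θ - ∑ i, A.w i • A.clientGrad D i θ = δ θ := by
      rw [← Finset.sum_sub_distrib, Finset.sum_eq_single s
        (fun i _ hi => by rw [hD i hi, sub_self]) (by simp), ← smul_sub]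
    simp only [smul_add, Finset.sum_add_distrib]
    rw [h1, ← h2, add_sub_cancel]
  refine A.le_tradeoff_of_shift D' ha (by positivity) (fun θ => ?_) (A.measurable_iterates D)
    (A.measurable_iterates D') (fun z => funext fun k => hiter z k) hα0 hα1
  have hc0 : 0 ≤ c := by positivity
  simp only [a, Finset.sum_const, Finset.card_univ, Fintype.card_fin, nsmul_eq_mul, norm_smul]
  rw [Real.norm_of_nonneg (by positivity : 0 ≤ (m * c)⁻¹), div_pow, Real.sq_sqrt hm.le]
  calc _ ≤ A.K * (m * ((m * c)⁻¹ * (2 * B / N)) ^ 2) := by gcongr; exact hδ θ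
    _ ≤ μ ^ 2 / m := by
      by_cases hK : (A.K : ℝ) = 0
      · simp only [hK, zero_mul]; positivity
      by_cases hB0 : B = 0
      · simp only [hB0, mul_zero, zero_div, ne_eq, OfNat.ofNat_ne_zero, not_false_eq_true, zero_pow]
        positivity
      have hsq : √(A.K : ℝ) ^ 2 = A.K := Real.sq_sqrt (Nat.cast_nonneg _)
      have hsq0 : √(A.K : ℝ) ≠ 0 := fun h => hK (by rw [← hsq, h]; simp)
      refine le_of_eq ?_
      simp only [c]
      nth_rewrite 1 [← hsq]
      field_simp

end FedSGD

end

theorem lemma3p1 {X : Type*} {d m : ℕ} (n : Fin m → ℕ) (hn : ∀ i, 1 ≤ n i)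
    (A : FedSGD X d m) (μ B : ℝ) (hμ : 0 < μ)
    (hdiff : ∀ x, Differentiable ℝ (A.loss x))
    (hbound : ∀ x θ, ‖gradient (A.loss x) θ‖ ≤ B)
    (hw : ∀ i, A.w i ∈ Set.Icc (0 : ℝ) 1) (hwsum : ∑ i, A.w i = 1)
    (hσ : ∀ i, A.sigma i = 2 * B * √(A.K : ℝ) / (μ * (n i : ℝ))) :
    IsFedGDP μ (fun D : FedData n X => A.serverView D) ∧
    ((∀ i, A.w i = (n i : ℝ) / ∑ j, (n j : ℝ)) →
      IsGDP (μ / √(m : ℝ))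
        (fun D : ((i : Fin m) × Fin (n i)) → X => A.thirdPartyView fun i j => D ⟨i, j⟩)) :=
  ⟨A.isFedGDP_serverView hn hμ hbound hσ, fun hw => A.isGDP_thirdPartyView hn hμ hbound hσ hw⟩
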